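/- Let $R$ be an associative ring with unity and let $\mathcal{X}$ be a class of $R$-modules. A complex is a chain complex $\cdots\to X_{n+1}\to X_n\to X_{n-1}\to\cdots$ of $R$-modules indexed by $n\in\mathbb{Z}$, and $C(\mathcal{X}^*)$ denotes the class of all complexes $X$ with $X_n\in\mathcal{X}$ for every $n\in\mathbb{Z}$. For a class $\mathcal{Y}$ of objects of a category, a $\mathcal{Y}$-precover of an object $M$ is a morphism $\varphi:Y\to M$ with $Y\in\mathcal{Y}$ such that every morphism $Y'\to M$ with $Y'\in\mathcal{Y}$ factors through $\varphi$; it is a $\mathcal{Y}$-cover if moreover every endomorphism $g$ of $Y$ with $\varphi g=\varphi$ is an automorphism. Direct and inverse limits are taken over nonempty directed partially ordered sets. Theorem 2.7. Suppose that $\mathcal{X}$ is closed under arbitrary direct sums and under extensions, and that $C(\mathcal{X}^*)$ is closed under inverse limits and under direct limits. If every $R$-module has an $\mathcal{X}$-cover, then every complex of $R$-modules has a $C(\mathcal{X}^*)$-cover. -/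

import Mathlib

open CategoryTheory CategoryTheory.Limits

universe u

namespace XStar

section Covers

variable {C : Type*} [Category C]

/-- `φ : X ⟶ M` is a `P`-precover of `M`: the source `X` belongs to the class `P`, and every
morphism `X' ⟶ M` with `X'` in `P` factors through `φ`. -/
def IsPrecover (P : ObjectProperty C) {X M : C} (φ : X ⟶ M) : Prop :=
  P X ∧ ∀ ⦃X' : C⦄, P X' → ∀ f : X' ⟶ M, ∃ g : X' ⟶ X, g ≫ φ = f

/-- `φ : X ⟶ M` is a `P`-cover of `M`: it is a `P`-precover, and every endomorphism `g` of `X`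
with `g ≫ φ = φ` is an automorphism. -/
def IsCover (P : ObjectProperty C) {X M : C} (φ : X ⟶ M) : Prop :=
  IsPrecover P φ ∧ ∀ g : X ⟶ X, g ≫ φ = φ → IsIso g

/-- The object `M` has a `P`-cover. -/
def HasCover (P : ObjectProperty C) (M : C) : Prop :=
  ∃ (X : C) (φ : X ⟶ M), IsCover P φ

/-- `P` is closed under direct limits, that is, under colimits of direct systems indexed by
nonempty directed partially ordered sets. -/
def ClosedUnderDirectLimits (P : ObjectProperty C) : Prop :=
  ∀ (J : Type u) [PartialOrder J] [IsDirectedOrder J] [Nonempty J],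
    P.IsClosedUnderColimitsOfShape J

/-- `P` is closed under inverse limits, that is, under limits of inverse systems indexed by
nonempty directed partially ordered sets. -/
def ClosedUnderInverseLimits (P : ObjectProperty C) : Prop :=
  ∀ (J : Type u) [PartialOrder J] [IsDirectedOrder J] [Nonempty J],
    P.IsClosedUnderLimitsOfShape Jᵒᵖ

end Covers

/-- The class `𝒳` of modules is closed under arbitrary direct sums. -/
def ClosedUnderDirectSums {R : Type u} [Ring R] (𝒳 : ObjectProperty (ModuleCat.{u} R)) : Prop :=
  ∀ J : Type u, 𝒳.IsClosedUnderColimitsOfShape (Discrete J)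

/-- The class `C(𝒳*)` of chain complexes indexed by `ℤ` all of whose terms belong to `𝒳`. -/
def complexesOf {R : Type u} [Ring R] (𝒳 : ObjectProperty (ModuleCat.{u} R)) :
    ObjectProperty (ChainComplex (ModuleCat.{u} R) ℤ) :=
  fun K => ∀ n : ℤ, 𝒳 (K.X n)

end XStar

-- A precover of a complex `Y` is built as the limit of a tower: `T 0 = Y`, and `T (n + 1)` is the
-- complex of pairs for chosen precovers of the terms of `T n`. In each degree `T (n + 1) ⟶ T n`
-- passes through a module in `𝒳`, so the limit is also a limit of modules in `𝒳`; a map from a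
-- complex with terms in `𝒳` lifts up the tower step by step. A precover is a weakly terminal object
-- of the category of objects of the class over `Y`, and a cover is one whose endomorphisms are
-- invertible. Transfinite sequences and cardinality bounds turn the former into the latter
-- (`exists_weaklyTerminal_forall_isIso`).

universe w

namespace XStar

/-! ### Sequential limits: from complexes to modules. -/

section ModuleLimits

variable {R : Type u} [Ring R]

/-- The complex equal to a given module in every degree, with zero differentials. -/
noncomputable def zeroDifferential :
    ModuleCat.{u} R ⥤ ChainComplex (ModuleCat.{u} R) ℤ where
  obj M := { X := fun _ => M, d := fun _ _ => 0 }
  map f := { f := fun _ => f }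

/-- A class of modules is closed under inverse limits of sequences when the class of complexes with
terms in it is closed under inverse limits. -/
lemma ClosedUnderInverseLimits.isClosedUnderLimitsOfShape_nat {𝒳 : ObjectProperty (ModuleCat.{u} R)}
    (h : ClosedUnderInverseLimits.{u} (complexesOf 𝒳)) : 𝒳.IsClosedUnderLimitsOfShape ℕᵒᵖ := by
  have h₁ := h (ULift.{u} ℕ)
  have : PreservesLimitsOfShape (ULift.{u} ℕ)ᵒᵖ (zeroDifferential (R := R)) :=
    HomologicalComplex.preservesLimitsOfShape_of_eval _ fun _ =>
      inferInstanceAs (PreservesLimitsOfShape _ (𝟭 (ModuleCat.{u} R)))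
  have h₂ : 𝒳.IsClosedUnderLimitsOfShape (ULift.{u} ℕ)ᵒᵖ := ⟨fun _ ⟨c⟩ =>
    ObjectProperty.LimitOfShape.prop (P := complexesOf 𝒳)
      ⟨c.toLimitPresentation.map zeroDifferential, fun j _ => c.prop_diag_obj j⟩ (0 : ℤ)⟩
  exact .of_equivalence (ULift.orderIso.{u} (α := ℕ)).equivalence.op

end ModuleLimits

/-! ### Interleaved towers. -/

section Sequence

variable {C : Type*} [Category C]

/-- Interleaved sequences have the same limit: if the terms of one of them belong to a class closed
under sequential limits, then so does the limit of the other one. -/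
lemma prop_of_isLimit_of_interleaved {P : ObjectProperty C} [P.IsClosedUnderLimitsOfShape ℕᵒᵖ]
    {F G : ℕᵒᵖ ⥤ C} (b : G ⟶ F) (a : ∀ n : ℕ, F.obj ⟨n + 1⟩ ⟶ G.obj ⟨n⟩)
    (hab : ∀ n : ℕ, a n ≫ b.app ⟨n⟩ = F.map (homOfLE n.le_succ).op)
    (hba : ∀ n : ℕ, b.app ⟨n + 1⟩ ≫ a n = G.map (homOfLE n.le_succ).op)
    {c : Cone F} (hc : IsLimit c) (hG : ∀ n, P (G.obj n)) : P c.pt := by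
  -- The legs are shifted by one: `a n` starts at index `n + 1` of `F`.
  let cG : Cone G :=
    { pt := c.pt
      π := NatTrans.ofOpSequence (fun n => c.π.app ⟨n + 1⟩ ≫ a n) fun n => by
        have h := c.w (homOfLE (n + 1).le_succ).op
        change 𝟙 c.pt ≫ _ = (_ ≫ a (n + 1)) ≫ G.map (homOfLE n.le_succ).op
        rw [← hba, Category.assoc, reassoc_of% hab, reassoc_of% h, Category.id_comp] }
  have hcG : IsLimit cG :=
    { lift := fun s => hc.lift ((Cone.postcompose b).obj s)
      fac := fun s ⟨n⟩ => by
        change hc.lift ((Cone.postcompose b).obj s) ≫ c.π.app ⟨n + 1⟩ ≫ a n = _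
        rw [hc.fac_assoc]
        change (s.π.app ⟨n + 1⟩ ≫ b.app ⟨n + 1⟩) ≫ a n = _
        rw [Category.assoc, hba, s.w]
      uniq := fun s m hm => hc.uniq ((Cone.postcompose b).obj s) _ fun ⟨n⟩ => by
        change _ = s.π.app ⟨n⟩ ≫ b.app ⟨n⟩
        rw [← hm ⟨n⟩, ← c.w (homOfLE n.le_succ).op, ← hab n]
        change _ = (m ≫ c.π.app ⟨n + 1⟩ ≫ a n) ≫ _
        simp only [Category.assoc] }
  exact (P.prop_of_isLimit hcG hG : P cG.pt)

end Sequence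

/-! ### Lifting degreewise factorizations to chain maps. -/

section Pullback

variable {R : Type u} [Ring R] {ι : Type} {c : ComplexShape ι}
  {K : HomologicalComplex (ModuleCat.{u} R) c} {X : ι → ModuleCat.{u} R} (φ : ∀ i, X i ⟶ K.X i)

/-- The pairs consisting of an element of `X i` and of lifts along `φ` of its differential. -/
def pairs (i : ι) : Submodule R (X i × ∀ j : {j // c.Rel i j}, X j) where
  carrier := {x | ∀ j : {j // c.Rel i j}, K.d i j (φ i x.1) = φ j (x.2 j)}
  add_mem' hx hy j := by simp [hx j, hy j]
  zero_mem' j := by simp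
  smul_mem' r x hx j := by simp [hx j]

open Classical in
/-- The complex of pairs. It is the pullback of `K` and of the contractible complex
cogenerated by `X`. -/
noncomputable def pairsComplex : HomologicalComplex (ModuleCat.{u} R) c where
  X i := ModuleCat.of R (pairs φ i)
  d i k := if h : c.Rel i k then
      ModuleCat.ofHom (LinearMap.codRestrict (pairs φ k)
        (LinearMap.inl R _ _ ∘ₗ LinearMap.proj (⟨k, h⟩ : {j // c.Rel i j}) ∘ₗ
          LinearMap.snd R _ _ ∘ₗ (pairs φ i).subtype) fun x j => by
            have := x.2 ⟨k, h⟩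
            simp only [LinearMap.comp_apply, LinearMap.inl_apply]
            change K.d k j (φ k (x.1.2 ⟨k, h⟩)) = φ j 0
            rw [← this, ← ConcreteCategory.comp_apply, K.d_comp_d]
            simp)
    else 0
  shape i k h := dif_neg h
  d_comp_d' i j k hij hjk := by
    rw [dif_pos hij, dif_pos hjk]
    exact ModuleCat.hom_ext (LinearMap.ext fun x => Subtype.ext (Prod.ext rfl rfl))

lemma pairsComplex_d_apply {i k : ι} (h : c.Rel i k) (x : pairs φ i) :
    (((pairsComplex φ).d i k).hom x : pairs φ k).1 = (x.1.2 ⟨k, h⟩, 0) := by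
  simp only [pairsComplex, dif_pos h]
  rfl

/-- The first projection from the pairs in a given degree. -/
noncomputable def pairsFst (i : ι) : (pairsComplex φ).X i ⟶ X i :=
  ModuleCat.ofHom (LinearMap.fst R _ _ ∘ₗ (pairs φ i).subtype)

/-- The chain map sending a pair to the image of its first component. -/
noncomputable def pairsDesc : pairsComplex φ ⟶ K where
  f i := pairsFst φ i ≫ φ i
  comm' i j h := by
    ext x
    change K.d i j (φ i (x : pairs φ i).1.1) = φ j (((pairsComplex φ).d i j).hom x : pairs φ j).1.1
    refine ((x : pairs φ i).2 ⟨j, h⟩).trans ?_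
    exact congrArg (fun y => φ j y.1) (pairsComplex_d_apply φ h x).symm

/-- A chain map that factors through `φ` in each degree factors through the complex of pairs. -/
lemma exists_comp_pairsDesc {L : HomologicalComplex (ModuleCat.{u} R) c} (f : L ⟶ K)
    (h : ∀ i, ∃ g : L.X i ⟶ X i, g ≫ φ i = f.f i) : ∃ g : L ⟶ pairsComplex φ, g ≫ pairsDesc φ = f := by
  choose g hg using h
  have hg' (i : ι) (x : L.X i) : φ i (g i x) = f.f i x := by
    rw [← hg]; rfl
  -- The maps `g i` need not commute with the differentials; recording `g j (d x)` beside `g i x` is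
  -- what yields a chain map.
  refine ⟨{ f := fun i => ModuleCat.ofHom (LinearMap.codRestrict (pairs φ i)
      ((g i).hom.prod (LinearMap.pi fun j => (L.d i j ≫ g j).hom)) fun x j => ?_)
            comm' := fun i k h => ?_ }, ?_⟩
  · change K.d i j (φ i (g i x)) = φ j (g j (L.d i j x))
    rw [hg', hg', ← ConcreteCategory.comp_apply, ← ConcreteCategory.comp_apply, f.comm]
  · ext x
    apply Subtype.ext
    refine (pairsComplex_d_apply φ h _).trans ?_
    refine Prod.ext rfl (funext fun j => ?_)
    change 0 = g j (L.d k j (L.d i k x))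
    rw [← ConcreteCategory.comp_apply (L.d i k), L.d_comp_d]
    simp
  · ext i x
    exact hg' i x

end Pullback

/-! ### Weakly terminal objects and transfinite sequences. -/

section Transfinite

open Cardinal

variable {A : Type*} [Category A] {I : Type} (U : I → A ⥤ Type w)

lemma map_apply_map_apply (G : A ⥤ Type w) {X Y Z : A} {f : X ⟶ Y} {g : Y ⟶ Z} {h : X ⟶ Z}
    (w : f ≫ g = h) (x : G.obj X) : G.map g (G.map f x) = G.map h x := by
  rw [← w, Functor.map_comp, ConcreteCategory.comp_apply]

section Stages

variable {J : Type w} [LinearOrder J] {κ : Cardinal.{w}} [hκ : Fact κ.IsRegular]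
  [IsCardinalFiltered J κ] {F : J ⥤ A} {c : Cocone F} (hc : ∀ i, IsColimit ((U i).mapCocone c))

include κ hc

variable (κ) in
/-- The identifications that a `κ`-filtered colimit makes among fewer than `κ` elements of a term
are already made at some later term. -/
lemma exists_le_forall_map_eq (j : J) (hj : #(Σ i, (U i).obj (F.obj j)) < κ) :
    ∃ (k : J) (h : j ≤ k), ∀ i x y, (U i).map (c.ι.app j) x = (U i).map (c.ι.app j) y →
      (U i).map (F.map (homOfLE h)) x = (U i).map (F.map (homOfLE h)) y := by
  have := isFiltered_of_isCardinalFiltered J κ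
  have hpair : HasCardinalLT (Σ i, (U i).obj (F.obj j) × (U i).obj (F.obj j)) κ := by
    rw [hasCardinalLT_iff_cardinal_mk_lt]
    refine lt_of_le_of_lt ?_ (mul_lt_of_lt hκ.out.aleph0_le hj hj)
    rw [mul_def]
    refine mk_le_of_injective (f := fun z => (⟨z.1, z.2.1⟩, ⟨z.1, z.2.2⟩)) ?_
    rintro ⟨i, x, y⟩ ⟨i', x', y'⟩ h
    simp only [Prod.mk.injEq, Sigma.mk.injEq] at h
    obtain ⟨⟨rfl, hx⟩, -, hy⟩ := h
    cases hx
    cases hy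
    rfl
  have hstage (z : Σ i, (U i).obj (F.obj j) × (U i).obj (F.obj j)) :
      ∃ (k : J) (h : j ≤ k),
        (U z.1).map (c.ι.app j) z.2.1 = (U z.1).map (c.ι.app j) z.2.2 →
          (U z.1).map (F.map (homOfLE h)) z.2.1 = (U z.1).map (F.map (homOfLE h)) z.2.2 := by
    by_cases hz : (U z.1).map (c.ι.app j) z.2.1 = (U z.1).map (c.ι.app j) z.2.2
    · obtain ⟨k, f, hf⟩ := (Types.FilteredColimit.isColimit_eq_iff' (hc z.1) z.2.1 z.2.2).1 hz
      exact ⟨k, leOfHom f, fun _ => hf⟩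
    · exact ⟨j, le_rfl, fun h => absurd h hz⟩
  choose k hk hkz using hstage
  let m := IsCardinalFiltered.max k hpair
  have hm (z) : k z ≤ m := leOfHom (IsCardinalFiltered.toMax k hpair z)
  refine ⟨max j m, le_max_left _ _, fun i x y hxy => ?_⟩
  have h : homOfLE (le_max_left j m) =
      homOfLE (hk ⟨i, x, y⟩) ≫ homOfLE ((hm _).trans (le_max_right _ _)) := rfl
  rw [h]
  simp only [Functor.map_comp, ConcreteCategory.comp_apply]
  exact congrArg _ (hkz ⟨i, x, y⟩ hxy)

variable (κ) in
/-- A `κ`-filtered colimit with fewer than `κ` elements is covered by some term. -/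
lemma exists_forall_surjective (hpt : #(Σ i, (U i).obj c.pt) < κ) :
    ∃ j, ∀ i, Function.Surjective ((U i).map (c.ι.app j)) := by
  have hstage (z : Σ i, (U i).obj c.pt) : ∃ j x, (U z.1).map (c.ι.app j) x = z.2 :=
    Types.jointly_surjective_of_isColimit (hc z.1) z.2
  choose j x hx using hstage
  have hlt := (hasCardinalLT_iff_cardinal_mk_lt _ _).2 hpt
  refine ⟨IsCardinalFiltered.max j hlt, fun i y => ?_⟩
  refine ⟨(U i).map (F.map (IsCardinalFiltered.toMax j hlt ⟨i, y⟩)) (x ⟨i, y⟩), ?_⟩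
  rw [map_apply_map_apply _ (c.w _)]
  exact hx ⟨i, y⟩

variable (κ) in
/-- In a continuous sequence of uncountable regular length whose successor terms are small, some
term embeds into the colimit. -/
lemma exists_forall_injective [SuccOrder J] [NoMaxOrder J] [WellFoundedLT J]
    [F.IsWellOrderContinuous] (hκ₀ : ℵ₀ < κ)
    (hU : ∀ (j : J), Order.IsSuccLimit j → ∀ i, PreservesColimitsOfShape (Set.Iio j) (U i))
    (hF : ∀ j, #(Σ i, (U i).obj (F.obj (Order.succ j))) < κ) :
    ∃ j, ∀ i, Function.Injective ((U i).map (c.ι.app j)) := by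
  have hstage (j : J) : ∃ (k : J) (h : j < k), ∀ i x y,
      (U i).map (c.ι.app j) x = (U i).map (c.ι.app j) y →
        (U i).map (F.map (homOfLE h.le)) x = (U i).map (F.map (homOfLE h.le)) y := by
    -- The passage to `Order.succ j` is needed because only successor terms are known to be small.
    obtain ⟨k, hk, hkz⟩ := exists_le_forall_map_eq U κ hc (Order.succ j) (hF j)
    refine ⟨k, (Order.lt_succ j).trans_le hk, fun i x y hxy => ?_⟩
    have h : homOfLE ((Order.lt_succ j).trans_le hk).le =
      homOfLE (Order.le_succ j) ≫ homOfLE hk := rfl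
    rw [h]
    simp only [Functor.map_comp, ConcreteCategory.comp_apply]
    refine hkz i _ _ ?_
    rwa [map_apply_map_apply _ (c.w _), map_apply_map_apply _ (c.w _)]
  choose next lt_next hnext using hstage
  obtain ⟨j₀⟩ := IsCardinalFiltered.nonempty J κ
  let a (n : ℕ) : J := next^[n] j₀
  have ha (n : ℕ) : a (n + 1) = next (a n) := Function.iterate_succ_apply' _ _ _
  have hlt (n : ℕ) : a n < a (n + 1) := by
    rw [ha]
    exact lt_next _
  have hub : (upperBounds (Set.range a)).Nonempty := by
    have h : HasCardinalLT ℕ κ := by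
      rw [← hasCardinalLT_iff_of_equiv (Equiv.ulift.{w} (α := ℕ)),
        hasCardinalLT_iff_cardinal_mk_lt]
      simpa using hκ₀
    refine ⟨IsCardinalFiltered.max a h, ?_⟩
    rintro _ ⟨n, rfl⟩
    exact leOfHom (IsCardinalFiltered.toMax a h n)
  -- At the supremum `γ` of the iterates of `next`, two elements of `F.obj γ` come from a common `a
  -- m`. If they agree in the colimit, they already agree at `next (a m) ≤ γ`.
  let γ := WellFounded.min (wellFounded_lt (α := J)) _ hub
  have hγ (n : ℕ) : a n < γ :=
    (hlt n).trans_le (WellFounded.min_mem wellFounded_lt _ hub ⟨n + 1, rfl⟩)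
  have hγ' (x : J) (hx : x < γ) : ∃ n, x < a n := by
    by_contra! h
    exact WellFounded.not_lt_min wellFounded_lt _ (x := x) (by rintro _ ⟨n, rfl⟩; exact h n) hx
  have hlim : Order.IsSuccLimit γ := by
    refine ⟨fun h => h.not_lt (hγ 0), fun x hx => ?_⟩
    obtain ⟨n, hn⟩ := hγ' x hx.1
    exact hx.2 hn (hγ n)
  have hmono : Monotone a := monotone_nat_of_le_succ fun n => (hlt n).le
  refine ⟨γ, fun i x y hxy => ?_⟩
  have := hU γ hlim i
  have hcγ := isColimitOfPreserves (U i) (F.isColimitOfIsWellOrderContinuous γ hlim)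
  have hrep (z : (U i).obj (F.obj γ)) (m : ℕ) : ∃ n, m ≤ n ∧ ∃ z' : (U i).obj (F.obj (a n)),
      (U i).map (F.map (homOfLE (hγ n).le)) z' = z := by
    obtain ⟨⟨j, hj⟩, (z' : (U i).obj (F.obj j)), hz'⟩ := Types.jointly_surjective_of_isColimit hcγ z
    obtain ⟨n, hn⟩ := hγ' j hj
    have hn' : j ≤ a (max m n) := hn.le.trans (hmono (le_max_right _ _))
    exact ⟨max m n, le_max_left _ _, (U i).map (F.map (homOfLE hn')) z',
      (map_apply_map_apply (U i) (F.map_comp _ _).symm z').trans hz'⟩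
  obtain ⟨n, -, x, rfl⟩ := hrep x 0
  obtain ⟨m, hm, y, rfl⟩ := hrep y n
  have hx : (U i).map (F.map (homOfLE (hγ n).le)) x = (U i).map (F.map (homOfLE (hγ m).le))
      ((U i).map (F.map (homOfLE (hmono hm))) x) :=
    (map_apply_map_apply (U i) (F.map_comp _ _).symm x).symm
  rw [hx] at hxy ⊢
  have hγm (z : (U i).obj (F.obj (a m))) : (U i).map (c.ι.app γ)
      ((U i).map (F.map (homOfLE (hγ m).le)) z) = (U i).map (c.ι.app (a m)) z :=
    map_apply_map_apply _ (c.w _) z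
  rw [hγm, hγm] at hxy
  have hle : next (a m) ≤ γ := (ha m).symm.trans_le (hγ (m + 1)).le
  have h (z : (U i).obj (F.obj (a m))) : (U i).map (F.map (homOfLE (hγ m).le)) z =
      (U i).map (F.map (homOfLE hle)) ((U i).map (F.map (homOfLE (lt_next (a m)).le)) z) :=
    (map_apply_map_apply (U i) (F.map_comp _ _).symm z).symm
  rw [h, h y, hnext (a m) i _ _ hxy]

end Stages

/-- The transfinite sequence with successor terms `W` and successor maps `p`. -/
lemma exists_iteration (hA : ∀ (J : Type w) [LinearOrder J] [Nonempty J], HasColimitsOfShape J A)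
    {W : A} (p : ∀ X : A, X ⟶ W) (κ : Cardinal.{w}) [hκ : Fact κ.IsRegular] :
    ∃ F : κ.ord.ToType ⥤ A, F.IsWellOrderContinuous ∧
      ∀ j, Nonempty (W ⟶ F.obj j) ∧ ∃ e : F.obj (Order.succ j) ≅ W,
        F.map (homOfLE (Order.le_succ j)) = p (F.obj j) ≫ e.inv := by
  have : NoMaxOrder κ.ord.ToType := Cardinal.noMaxOrder hκ.out.aleph0_le
  have : Nonempty κ.ord.ToType := IsCardinalFiltered.nonempty _ κ
  let : OrderBot κ.ord.ToType := WellFoundedLT.toOrderBot _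
  have : HasIterationOfShape κ.ord.ToType A :=
    { hasColimitsOfShape_of_isSuccLimit := fun j hj => by
        have : Nonempty (Set.Iio j) := ⟨⟨⊥, hj.bot_lt⟩⟩
        exact hA _
      hasColimitsOfShape := hA _ }
  -- Starting at `W` provides the maps from `W` to every term.
  let Φ : SmallObject.SuccStruct A := { X₀ := W, succ := fun _ => W, toSucc := p }
  exact ⟨Φ.iterationFunctor _, inferInstance, fun j =>
    ⟨⟨(Φ.ιIterationFunctor _).app j⟩, Φ.iterationFunctorObjSuccIso j (not_isMax j),
      Φ.iterationFunctor_map_succ j (not_isMax j)⟩⟩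

section WeaklyTerminal

variable (hA : ∀ (J : Type w) [LinearOrder J] [Nonempty J], HasColimitsOfShape J A)
  (hU : ∀ (J : Type w) [LinearOrder J] [Nonempty J] (i : I), PreservesColimitsOfShape J (U i))

include hA hU

/-- Some map of the given family of maps to `W` becomes injective after a map out of `W`, and its
source receives a map from `W`. -/
lemma exists_forall_injective_comp {W : A} (p : ∀ X : A, X ⟶ W) :
    ∃ (X E : A) (s : W ⟶ E), Nonempty (W ⟶ X) ∧
      ∀ i, Function.Injective ((U i).map (p X ≫ s)) := by
  let κ : Cardinal.{w} := Order.succ (max ℵ₀ #(Σ i, (U i).obj W))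
  have hκ : Fact κ.IsRegular := ⟨isRegular_succ (le_max_left _ _)⟩
  have hκ₀ : ℵ₀ < κ := (le_max_left _ _).trans_lt (Order.lt_succ _)
  have hκW : #(Σ i, (U i).obj W) < κ := (le_max_right _ _).trans_lt (Order.lt_succ _)
  have : NoMaxOrder κ.ord.ToType := Cardinal.noMaxOrder hκ.out.aleph0_le
  have : Nonempty κ.ord.ToType := IsCardinalFiltered.nonempty _ κ
  have := hA κ.ord.ToType
  have := hU κ.ord.ToType
  obtain ⟨F, hF, h⟩ := exists_iteration hA p κ
  have hsucc (j) : #(Σ i, (U i).obj (F.obj (Order.succ j))) < κ := by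
    obtain ⟨-, e, -⟩ := h j
    rwa [mk_congr (Equiv.sigmaCongrRight fun i => ((U i).mapIso e).toEquiv)]
  obtain ⟨j, hj⟩ := exists_forall_injective U κ
    (fun i => isColimitOfPreserves (U i) (colimit.isColimit F)) hκ₀
    (fun j hj => by
      have : Nonempty (Set.Iio j) := by
        obtain ⟨k, hk⟩ := not_isMin_iff.1 hj.1
        exact ⟨⟨k, hk⟩⟩
      exact hU _) hsucc
  obtain ⟨hne, e, he⟩ := h j
  -- The injective map `F.obj j ⟶ colimit F` factors through the successor term, hence through `p
  -- (F.obj j)`.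
  refine ⟨F.obj j, colimit F, e.inv ≫ colimit.ι F (Order.succ j), hne, fun i => ?_⟩
  rw [← Category.assoc, ← he, colimit.w]
  exact hj i

/-- If every map out of `W` is injective, then every family of maps from all objects to `W` contains
a surjective map. -/
lemma exists_forall_surjective_of_injective {W : A} (p : ∀ X : A, X ⟶ W)
    (hW : ∀ ⦃E : A⦄ (s : W ⟶ E) (i : I), Function.Injective ((U i).map s)) :
    ∃ X, ∀ i, Function.Surjective ((U i).map (p X)) := by
  let κ : Cardinal.{w} := Order.succ (max ℵ₀ #(Σ i, (U i).obj W))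
  have hκ : Fact κ.IsRegular := ⟨isRegular_succ (le_max_left _ _)⟩
  have hκW : #(Σ i, (U i).obj W) < κ := (le_max_right _ _).trans_lt (Order.lt_succ _)
  have : Nonempty κ.ord.ToType := IsCardinalFiltered.nonempty _ κ
  have := isFiltered_of_isCardinalFiltered κ.ord.ToType κ
  have := hA κ.ord.ToType
  have := hU κ.ord.ToType
  obtain ⟨F, hF, h⟩ := exists_iteration hA p κ
  have hc (i : I) := isColimitOfPreserves (U i) (colimit.isColimit F)
  -- Any two elements of the colimit come from one copy of `W`, and the composite `W ⟶ colimit F ⟶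
  -- W` is injective by `hW`. So the colimit is no larger than `W`.
  have hinj (i : I) : Function.Injective ((U i).map (p (colimit F))) := by
    intro x y hxy
    obtain ⟨j, (x' : (U i).obj (F.obj j)), (y' : (U i).obj (F.obj j)), hx, hy⟩ :=
      Types.FilteredColimit.jointly_surjective_of_isColimit₂ (hc i) x y
    obtain ⟨-, e, -⟩ := h j
    have hw : (F.map (homOfLE (Order.le_succ j)) ≫ e.hom) ≫
        e.inv ≫ colimit.ι F (Order.succ j) = colimit.ι F j := by simp
    replace hx : (U i).map (colimit.ι F j) x' = x := hx
    replace hy : (U i).map (colimit.ι F j) y' = y := hy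
    rw [← map_apply_map_apply _ hw] at hx hy
    subst hx hy
    have hcomp (z : (U i).obj W) : (U i).map (p (colimit F))
        ((U i).map (e.inv ≫ colimit.ι F (Order.succ j)) z) =
          (U i).map ((e.inv ≫ colimit.ι F (Order.succ j)) ≫ p (colimit F)) z :=
      map_apply_map_apply _ rfl z
    rw [hcomp, hcomp] at hxy
    rw [hW _ i hxy]
  have hpt : #(Σ i, (U i).obj (colimit F)) < κ :=
    (mk_le_of_injective (Function.injective_id.sigma_map hinj)).trans_lt hκW
  obtain ⟨j, hj⟩ := exists_forall_surjective U κ hc hpt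
  obtain ⟨-, e, he⟩ := h j
  refine ⟨F.obj j, fun i y => ?_⟩
  -- The surjection `F.obj j ⟶ colimit F` is `p (F.obj j)` followed by an injective map out of `W`,
  -- so `p (F.obj j)` is surjective.
  obtain ⟨x, hx⟩ := hj i ((U i).map (e.inv ≫ colimit.ι F (Order.succ j)) y)
  refine ⟨x, hW (e.inv ≫ colimit.ι F (Order.succ j)) i ?_⟩
  rw [map_apply_map_apply (U i) rfl, ← hx, ← Category.assoc, ← he, colimit.w]
  rfl

/-- A category with a weakly terminal object and with directed colimits, computed on underlying
sets, has a weakly terminal object all of whose endomorphisms are invertible. -/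
theorem exists_weaklyTerminal_forall_isIso
    (hiso : ∀ ⦃X Y : A⦄ (f : X ⟶ Y), (∀ i, Function.Bijective ((U i).map f)) → IsIso f)
    {W : A} (hW : ∀ X : A, Nonempty (X ⟶ W)) :
    ∃ W' : A, (∀ X : A, Nonempty (X ⟶ W')) ∧ ∀ g : W' ⟶ W', IsIso g := by
  classical
  obtain ⟨V, hV, hVinj⟩ : ∃ V : A, (∀ X : A, Nonempty (X ⟶ V)) ∧
      ∀ ⦃E : A⦄ (s : V ⟶ E) (i : I), Function.Injective ((U i).map s) := by
    -- Otherwise every `X` receiving a map from `W` is weakly terminal, so it has a non-injective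
    -- map out, hence one to `W`. Such a choice of `p` contradicts `exists_forall_injective_comp`.
    by_contra! hcon
    have hp (X : A) : ∃ p : X ⟶ W, Nonempty (W ⟶ X) → ∃ i, ¬ Function.Injective ((U i).map p) := by
      by_cases hX : Nonempty (W ⟶ X)
      · obtain ⟨E, s, i, hs⟩ := hcon X fun Z => ⟨(hW Z).some ≫ hX.some⟩
        refine ⟨s ≫ (hW E).some, fun _ => ⟨i, fun h => hs ?_⟩⟩
        rw [Functor.map_comp] at h
        exact Function.Injective.of_comp (f := (U i).map (hW E).some) fun x y hxy =>
          h (by simpa using hxy)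
      · exact ⟨(hW X).some, fun h => absurd h hX⟩
    choose p hp using hp
    obtain ⟨X, E, s, hX, hinj⟩ := exists_forall_injective_comp U hA hU p
    obtain ⟨i, hi⟩ := hp X hX
    exact hi fun x y hxy => hinj i (by
      simp only [Functor.map_comp, ConcreteCategory.comp_apply, hxy])
  refine ⟨V, hV, fun g => hiso g fun i => ⟨hVinj g i, fun y => ?_⟩⟩
  -- With every map to `V` chosen to factor through `g`, surjectivity of one of them gives that of
  -- `g`.
  obtain ⟨X, hX⟩ := exists_forall_surjective_of_injective U hA hU
    (fun X => (hV X).some ≫ g) hVinj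
  obtain ⟨x, hx⟩ := hX i y
  exact ⟨(U i).map (hV X).some x, (map_apply_map_apply (U i) rfl x).trans hx⟩

end WeaklyTerminal

end Transfinite

/-! ### Precovers and covers of complexes. -/

/-- If every module has an `𝒳`-precover, then every complex has a precover by complexes with terms
in `𝒳`. -/
theorem exists_isPrecover_complexesOf {R : Type u} [Ring R] {𝒳 : ObjectProperty (ModuleCat.{u} R)}
    (h_inv : ClosedUnderInverseLimits.{u} (complexesOf 𝒳))
    (h : ∀ M : ModuleCat.{u} R, ∃ (X : ModuleCat.{u} R) (φ : X ⟶ M), IsPrecover 𝒳 φ)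
    (Y : ChainComplex (ModuleCat.{u} R) ℤ) :
    ∃ (X : ChainComplex (ModuleCat.{u} R) ℤ) (φ : X ⟶ Y), IsPrecover (complexesOf 𝒳) φ := by
  have := h_inv.isClosedUnderLimitsOfShape_nat
  choose Z φ hφ using h
  let T (n : ℕ) : ChainComplex (ModuleCat.{u} R) ℤ :=
    n.rec Y fun _ K => pairsComplex fun i => φ (K.X i)
  let f (n : ℕ) : T (n + 1) ⟶ T n := pairsDesc fun i => φ ((T n).X i)
  let F : ℕᵒᵖ ⥤ ChainComplex (ModuleCat.{u} R) ℤ := Functor.ofOpSequence f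
  have hF (n : ℕ) : F.map (homOfLE n.le_succ).op = f n :=
    Functor.ofOpSequence_map_homOfLE_succ f n
  refine ⟨limit F, limit.π F ⟨0⟩, fun i => ?_, fun X' hX' g => ?_⟩
  · let a (n : ℕ) : (T (n + 1)).X i ⟶ Z ((T n).X i) := pairsFst (fun i => φ ((T n).X i)) i
    let G : ℕᵒᵖ ⥤ ModuleCat.{u} R := Functor.ofOpSequence fun n => φ ((T (n + 1)).X i) ≫ a n
    have hG (n : ℕ) : G.map (homOfLE n.le_succ).op = φ ((T (n + 1)).X i) ≫ a n :=
      Functor.ofOpSequence_map_homOfLE_succ (fun n => φ ((T (n + 1)).X i) ≫ a n) n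
    have hab (n : ℕ) : a n ≫ φ ((T n).X i) = (f n).f i := rfl
    have hF' (n : ℕ) :
        (F ⋙ HomologicalComplex.eval _ _ i).map (homOfLE n.le_succ).op = (f n).f i :=
      congrArg (fun f => HomologicalComplex.Hom.f f i) (hF n)
    let b : G ⟶ F ⋙ HomologicalComplex.eval _ _ i :=
      NatTrans.ofOpSequence (fun n => φ ((T n).X i)) fun n => by
        refine (congrArg (· ≫ φ ((T n).X i)) (hG n)).trans ?_
        refine Eq.trans ?_ (congrArg (φ ((T (n + 1)).X i) ≫ ·) (hF' n)).symm
        exact Category.assoc _ _ _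
    exact prop_of_isLimit_of_interleaved (P := 𝒳) b a (fun n => (hab n).trans (hF' n).symm)
      (fun n => (hG n).symm)
      (isLimitOfPreserves (HomologicalComplex.eval _ _ i) (limit.isLimit F))
      fun n => (hφ _).1
  · have hlift (n : ℕ) (k : X' ⟶ T n) : ∃ k' : X' ⟶ T (n + 1), k' ≫ f n = k :=
      exists_comp_pairsDesc _ k fun i => (hφ _).2 (hX' i) (k.f i)
    choose lift hlift using hlift
    let k (n : ℕ) : X' ⟶ T n := n.rec g lift
    let s : Cone F :=
      { pt := X'
        π := NatTrans.ofOpSequence k fun n => by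
          refine Eq.trans ?_ (congrArg (k (n + 1) ≫ ·) (hF n)).symm
          refine (Category.id_comp _).trans ?_
          exact (hlift n (k n)).symm }
    exact ⟨limit.lift F s, limit.lift_π s ⟨0⟩⟩

variable {R : Type u} [Ring R]

/-- In a class of complexes closed under direct limits, a complex with a precover has a cover. -/
theorem hasCover_of_isPrecover {P : ObjectProperty (ChainComplex (ModuleCat.{u} R) ℤ)}
    (h_dir : ClosedUnderDirectLimits.{u} P) {X Y : ChainComplex (ModuleCat.{u} R) ℤ} {φ : X ⟶ Y}
    (hφ : IsPrecover P φ) : HasCover P Y := by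
  let U (i : ℤ) : CostructuredArrow P.ι Y ⥤ Type u :=
    CostructuredArrow.proj P.ι Y ⋙ P.ι ⋙ HomologicalComplex.eval _ _ i ⋙ forget _
  -- Nonempty chains are directed, so `P` is closed under their colimits, which are therefore
  -- computed on complexes.
  have hA (J : Type u) [LinearOrder J] [Nonempty J] :
      HasColimitsOfShape J (CostructuredArrow P.ι Y) := by
    have := h_dir J
    infer_instance
  have hU (J : Type u) [LinearOrder J] [Nonempty J] (i : ℤ) : PreservesColimitsOfShape J (U i) := by
    have := h_dir J
    infer_instance
  have hiso ⦃K L : CostructuredArrow P.ι Y⦄ (f : K ⟶ L)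
      (hf : ∀ i, Function.Bijective ((U i).map f)) : IsIso f := by
    have (i : ℤ) : IsIso (f.left.hom.f i) :=
      (ConcreteCategory.isIso_iff_bijective (f.left.hom.f i)).2 (hf i)
    have : IsIso (P.ι.map f.left) := HomologicalComplex.Hom.isIso_of_components f.left.hom
    have : IsIso ((CostructuredArrow.proj P.ι Y).map f) := isIso_of_reflects_iso f.left P.ι
    exact isIso_of_reflects_iso f (CostructuredArrow.proj P.ι Y)
  let W : CostructuredArrow P.ι Y := 
    CostructuredArrow.mk (S := P.ι) (Y := (⟨X, hφ.1⟩ : P.FullSubcategory)) φ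
  have hW (K : CostructuredArrow P.ι Y) : Nonempty (K ⟶ W) := by
    obtain ⟨g, hg⟩ := hφ.2 K.left.property K.hom
    exact ⟨CostructuredArrow.homMk (ObjectProperty.homMk g) hg⟩
  obtain ⟨V, hV, hVend⟩ := exists_weaklyTerminal_forall_isIso U hA hU hiso hW
  refine ⟨V.left.obj, V.hom, ⟨V.left.property, fun X' hX' f => ?_⟩, fun g hg => ?_⟩
  · obtain ⟨k⟩ := hV (CostructuredArrow.mk (S := P.ι) (Y := (⟨X', hX'⟩ : P.FullSubcategory)) f)
    exact ⟨k.left.hom, CostructuredArrow.w k⟩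
  · have := hVend (CostructuredArrow.homMk (ObjectProperty.homMk g) hg)
    exact inferInstanceAs (IsIso ((CostructuredArrow.proj P.ι Y ⋙ P.ι).map
      (CostructuredArrow.homMk (ObjectProperty.homMk g) hg : V ⟶ V)))

end XStar

theorem theorem2p7 {R : Type u} [Ring R] (𝒳 : ObjectProperty (ModuleCat.{u} R))
    (h_sum : XStar.ClosedUnderDirectSums 𝒳)
    (h_ext : 𝒳.IsClosedUnderExtensions)
    (h_inv : XStar.ClosedUnderInverseLimits.{u} (XStar.complexesOf 𝒳))
    (h_dir : XStar.ClosedUnderDirectLimits.{u} (XStar.complexesOf 𝒳))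
    (h_cover : ∀ M : ModuleCat.{u} R, XStar.HasCover 𝒳 M) :
    ∀ Y : ChainComplex (ModuleCat.{u} R) ℤ, XStar.HasCover (XStar.complexesOf 𝒳) Y := by
  intro Y
  obtain ⟨X, φ, hφ⟩ := XStar.exists_isPrecover_complexesOf h_inv
    (fun M => (h_cover M).imp fun _ => Exists.imp fun _ h => h.1) Y
  exact XStar.hasCover_of_isPrecover h_dir hφ
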